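/- **Notation.** Let $2\le k\le n$. For $\lambda\in\mathbb R^n$ let $\sigma_m(\lambda)=\sum_{i_1<\dots<i_m}\lambda_{i_1}\cdots\lambda_{i_m}$, $\sigma_0=1$, and $$\Gamma_{k-1}=\{\lambda\in\mathbb R^n:\ \sigma_1(\lambda)>0,\dots,\sigma_{k-1}(\lambda)>0\}.$$ For real numbers $a_0,\dots,a_{k-2}\ge 0$ put $$G_a(\lambda)=\frac{\sigma_k(\lambda)}{\sigma_{k-1}(\lambda)}-\sum_{\ell=0}^{k-2}a_\ell\,\frac{\sigma_\ell(\lambda)}{\sigma_{k-1}(\lambda)} .$$ For a real symmetric $n\times n$ matrix $A$ let $\lambda(A)$ be its eigenvalues with multiplicity. On the unit sphere $\mathbb S^n\subset\mathbb R^{n+1}$ let $W_u=(u_{ij}+u\,\delta_{ij})$ be the spherical Hessian of $u$, where $u_{ij}$ are the second covariant derivatives of $u$ in an orthonormal basis of the tangent space (any choice at each point). **Proposition.** 1. (Eigenvalues.) $G_a$ is differentiable at each $\lambda\in\Gamma_{k-1}$ with $\partial G_a/\partial\lambda_i\ge 0$ for all $i$, and $\partial G_a/\partial\lambda_i>0$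 for all $i$ if $\sum_{\ell=0}^{k-2}a_\ell>0$. The cone $\Gamma_{k-1}$ is convex and $G_a$ is concave on it. 2. (Matrices.) For each symmetric $A$ with $\lambda(A)\in\Gamma_{k-1}$ there is a positive semidefinite symmetric matrix $(G^{ij})$, positive definite if $\sum_{\ell}a_\ell>0$, such that $\frac{d}{dt}\big|_{t=0}G_a(\lambda(A+tB))=\sum_{i,j}G^{ij}B_{ij}$ for all symmetric $B$. The set of symmetric $A$ with $\lambda(A)\in\Gamma_{k-1}$ is convex and $A\mapsto G_a(\lambda(A))$ is concave on it. 3. (Hessian.) Let $\Omega\subset\mathbb R^n$ be open and let $\alpha_0,\dots,\alpha_{k-2}:\Omega\to[0,\infty)$ be functions. Call $u\in C^2(\Omega)$ (for instance, $u$ smooth) admissible if $\lambda(D^2u(x))\in\Gamma_{k-1}$ for all $x\in\Omega$, and put $\mathcal G[u](x)=G_{\alpha(x)}(\lambda(D^2u(x)))$, where $\alpha(x)=(\alpha_0(x),\dots,\alpha_{k-2}(x))$. Then $\mathcal G$ is elliptic at every admissible $u$: for each $x\in\Omega$ there is a positive semidefinite symmetric matrix $(G^{ij})$, positive definite if $\sum_\ell\alpha_\ell(x)>0$,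 such that $\frac{d}{dt}\big|_{t=0}\mathcal G[u+t\varphi](x)=\sum_{i,j}G^{ij}\,(D^2\varphi(x))_{ij}$ for all $\varphi\in C^2(\Omega)$. Moreover the set of admissible functions is convex, and for each $x\in\Omega$ the map $u\mapsto\mathcal G[u](x)$ is concave on it. 4. (Spherical Hessian.) The same holds with $\Omega$ replaced by $\mathbb S^n$ and with $D^2u$, $D^2\varphi$ replaced by $W_u$, $W_\varphi$. -/

import Mathlib

open scoped Manifold ContDiff

noncomputable section

namespace HessianQuotient

/-- The `m`-th elementary symmetric function of the numbers `lam 0, …, lam (n-1)`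
(equal to `1` for `m = 0` and to `0` for `m > n`). -/
def sigma {n : ℕ} (m : ℕ) (lam : Fin n → ℝ) : ℝ :=
  ∑ s ∈ (Finset.univ : Finset (Fin n)).powersetCard m, ∏ i ∈ s, lam i

/-- The cone `Γ_m` in `ℝⁿ`: all of `σ_1, …, σ_m` are positive. -/
def Gam (n m : ℕ) : Set (Fin n → ℝ) :=
  {lam | ∀ j : ℕ, 1 ≤ j → j ≤ m → 0 < sigma j lam}

/-- `G(λ) = σ_k(λ)/σ_{k-1}(λ) - ∑_{ℓ=0}^{k-2} a_ℓ σ_ℓ(λ)/σ_{k-1}(λ)` (used for `k ≥ 2`). -/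
def G {n : ℕ} (k : ℕ) (a : ℕ → ℝ) (lam : Fin n → ℝ) : ℝ :=
  sigma k lam / sigma (k - 1) lam
    - ∑ l ∈ Finset.range (k - 1), a l * (sigma l lam / sigma (k - 1) lam)

open scoped Classical in
/-- The eigenvalues, with multiplicity, of a real symmetric matrix
(with the value `0` for a matrix that is not symmetric, which is never used). -/
def eigenvals {n : ℕ} (A : Matrix (Fin n) (Fin n) ℝ) : Fin n → ℝ :=
  if h : A.IsHermitian then h.eigenvalues else 0

/-- The symmetric `n × n` matrices whose eigenvalues lie in `Γ_m`. -/
def MatGam (n m : ℕ) : Set (Matrix (Fin n) (Fin n) ℝ) :=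
  {A | A.IsSymm ∧ eigenvals A ∈ Gam n m}

/-- The Hessian matrix `D²u(x)` of a function on `ℝⁿ`, with entries `∂_i ∂_j u (x)`. -/
def hess {n : ℕ} (u : EuclideanSpace ℝ (Fin n) → ℝ) (x : EuclideanSpace ℝ (Fin n)) :
    Matrix (Fin n) (Fin n) ℝ :=
  Matrix.of fun i j =>
    fderiv ℝ (fun y => fderiv ℝ u y (EuclideanSpace.single j 1)) x (EuclideanSpace.single i 1)

/-- The unit sphere `𝕊ⁿ` in `ℝⁿ⁺¹`. -/
abbrev Sph (n : ℕ) : Type :=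
  Metric.sphere (0 : EuclideanSpace ℝ (Fin (n + 1))) 1

/-- The extension `y ↦ f (y / |y|)` of a map on the sphere, constant along rays. -/
def radialExt {n : ℕ} {F : Type*} [Zero F] (f : Sph n → F) :
    EuclideanSpace ℝ (Fin (n + 1)) → F :=
  fun y => Function.extend (Subtype.val : Sph n → EuclideanSpace ℝ (Fin (n + 1))) f 0 (‖y‖⁻¹ • y)

/-- The gradient on the sphere of a function `u` at `x`, as a vector of `ℝⁿ⁺¹` orthogonal to `x`.
As the radial extension has no radial derivative, its gradient is the tangential gradient. -/
def sphGrad {n : ℕ} (u : Sph n → ℝ) (x : Sph n) : EuclideanSpace ℝ (Fin (n + 1)) :=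
  gradient (radialExt u) (x : EuclideanSpace ℝ (Fin (n + 1)))

/-- The second covariant derivative `∇²u (v, w) = ⟨∇_v (grad u), w⟩` at `x`, for `v`, `w` tangent
to the sphere at `x`. The Levi-Civita derivative of a tangent field in the direction `v` is the
tangential part of its derivative along `v` in `ℝⁿ⁺¹`; the normal part drops out in the inner
product with the tangent vector `w`. -/
def covHess {n : ℕ} (u : Sph n → ℝ) (x : Sph n) (v w : EuclideanSpace ℝ (Fin (n + 1))) : ℝ :=
  inner ℝ (fderiv ℝ (radialExt (sphGrad u)) (x : EuclideanSpace ℝ (Fin (n + 1))) v) w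

/-- The tangent space `x^⊥` of the sphere at `x`. -/
abbrev TSph {n : ℕ} (x : Sph n) : Submodule ℝ (EuclideanSpace ℝ (Fin (n + 1))) :=
  (Submodule.span ℝ {(x : EuclideanSpace ℝ (Fin (n + 1)))})ᗮ

/-- The spherical Hessian `W_u(x) = (u_ij + u δ_ij)` with respect to an orthonormal basis `e` of the
tangent space at `x`. -/
def W {n : ℕ} (u : Sph n → ℝ) (x : Sph n) (e : OrthonormalBasis (Fin n) ℝ (TSph x)) :
    Matrix (Fin n) (Fin n) ℝ :=
  Matrix.of fun i j =>
    covHess u x (e i : EuclideanSpace ℝ (Fin (n + 1))) (e j : EuclideanSpace ℝ (Fin (n + 1)))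
      + u x * (if i = j then 1 else 0)

/-- Admissible functions on `Ω ⊆ ℝⁿ`: of class `C²` with `λ(D²u) ∈ Γ_m` on `Ω`. -/
def AdmEuclid {n : ℕ} (m : ℕ) (Ω : Set (EuclideanSpace ℝ (Fin n))) :
    Set (EuclideanSpace ℝ (Fin n) → ℝ) :=
  {u | ContDiffOn ℝ 2 u Ω ∧ ∀ x ∈ Ω, hess u x ∈ MatGam n m}

/-- Admissible functions on `𝕊ⁿ`: of class `C²` with `λ(W_u) ∈ Γ_m`, where `W_u` is written in the
orthonormal bases `e x` of the tangent spaces. -/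
def AdmSph {n : ℕ} (m : ℕ) (e : ∀ x : Sph n, OrthonormalBasis (Fin n) ℝ (TSph x)) :
    Set (Sph n → ℝ) :=
  {u | ContMDiff (𝓡 n) 𝓘(ℝ, ℝ) 2 u ∧ ∀ x, W u x (e x) ∈ MatGam n m}

end HessianQuotient

end

namespace HessianQuotient

/-! ### Newton's inequalities from real-rootedness. -/

section Newton

open Polynomial

/-! Everything rests on Newton's inequality for the real-rooted polynomial `∏ (1 + x_i X)`. It shows
that deleting a variable lowers the order of the cone by at most one (`posCone_erase`), so
inductions can pass to smaller index sets.

Concavity of `σ_{m+1}/σ_m` is proved by induction on `m`: `(m+2) σ_{m+2}/σ_{m+1}` is the sum over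
`i` of `x_i - x_i² / (x_i + q_i)`, with `q_i` the quotient one degree lower without `x_i`; `q_i` is
concave by induction, and a linear function squared over a positive concave one is convex. For `l ≤
m`, `log (σ_l/σ_m)` is a sum of terms `-log (σ_{j+1}/σ_j)`, hence convex, and so is its exponential.
Monotonicity is again Newton's inequality, in the remaining variables.

For matrices, the diagonal of `A` in any orthonormal basis is a doubly stochastic image of its
eigenvalues, so by Birkhoff a symmetric concave function does not decrease on passing from the
eigenvalues to the diagonal (`le_apply_diagIn`). In an eigenbasis of a convex combination this gives
concavity. In an eigenbasis of `A` it makes `G` of the diagonal of `A + tB` touch `G (λ(A + tB))`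
from above at `t = 0`, which identifies the derivative without differentiating eigenvalues.

The Hessian operators follow because `D²u` and `W_u` are symmetric and linear in `u`; on the sphere
both facts are read off from the radial extension of `u`. -/

lemma splits_derivative {p : ℝ[X]} (hp : p.Splits) : (derivative p).Splits := by
  rcases Nat.eq_zero_or_pos p.natDegree with h | h
  · rw [derivative_of_natDegree_zero h]; exact Splits.zero
  · rw [splits_iff_card_roots] at hp ⊢
    have h1 := card_roots_le_derivative p
    have h2 := natDegree_derivative_lt h.ne'
    have h3 := card_roots' (derivative p)
    omega

/-- Add one root at a time: for `p = (X - c) q`, `p'² - p p'' = q² + (x - c)² (q'² - q q'')`. -/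
lemma laguerre_inequality {p : ℝ[X]} (hp : p.Splits) (x : ℝ) :
    p.eval x * (derivative (derivative p)).eval x ≤ (derivative p).eval x ^ 2 := by
  obtain ⟨m, hm⟩ := splits_iff_exists_multiset.1 hp
  have key : ∀ m : Multiset ℝ, (m.map (X - C ·)).prod.eval x *
      (derivative (derivative (m.map (X - C ·)).prod)).eval x ≤
      (derivative (m.map (X - C ·)).prod).eval x ^ 2 := by
    intro m
    induction m using Multiset.induction_on with
    | empty => simp
    | cons c m ih =>
      simp only [Multiset.map_cons, Multiset.prod_cons]
      generalize (m.map (X - C ·)).prod = q at ih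
      simp only [derivative_mul, derivative_sub, derivative_X, derivative_C, sub_zero, one_mul,
        derivative_add, eval_add, eval_mul, eval_sub, eval_X, eval_C]
      nlinarith [mul_le_mul_of_nonneg_left ih (sq_nonneg (x - c)), sq_nonneg (q.eval x)]
  have h := mul_le_mul_of_nonneg_left (key m) (sq_nonneg p.leadingCoeff)
  rw [hm]
  generalize (m.map (X - C ·)).prod = q at h
  generalize p.leadingCoeff = a at h
  simp only [derivative_mul, derivative_C, zero_mul, zero_add, eval_mul, eval_C]
  nlinarith [h]

lemma newton_coeff {p : ℝ[X]} (hp : p.Splits) (m : ℕ) :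
    (m + 2) * (p.coeff m * p.coeff (m + 2)) ≤ (m + 1) * p.coeff (m + 1) ^ 2 := by
  have hs : (derivative^[m] p).Splits := by
    induction m with
    | zero => simpa using hp
    | succ m ih => rw [Function.iterate_succ_apply']; exact splits_derivative ih
  have h := laguerre_inequality hs 0
  rw [← Function.iterate_succ_apply' derivative, ← Function.iterate_succ_apply' derivative] at h
  simp only [← coeff_zero_eq_eval_zero, coeff_iterate_derivative, zero_add,
    Nat.descFactorial_self, nsmul_eq_mul, Nat.factorial_succ] at h
  push_cast at h
  -- The common factor of `m! (m+2)!` and `(m+1)!²`, which arise from the derivatives of orders `m`,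
  -- `m+1`, `m+2` at `0`.
  have hf : (0 : ℝ) < (m.factorial : ℝ) ^ 2 * (m + 1) := by positivity
  refine le_of_mul_le_mul_left ?_ hf
  have e : m + 1 + 1 = m + 2 := rfl
  simp only [Nat.succ_eq_add_one, e] at h
  nlinarith [h]

end Newton

/-! ### Elementary symmetric functions over a finite index set and their cones. -/

variable {ι : Type*}

/-- The elementary symmetric function of degree `m` of the numbers `x i`, `i ∈ S`. -/
noncomputable def elem (S : Finset ι) (m : ℕ) (x : ι → ℝ) : ℝ :=
  ∑ s ∈ S.powersetCard m, ∏ i ∈ s, x i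

@[simp] lemma elem_zero (S : Finset ι) (x : ι → ℝ) : elem S 0 x = 1 := by simp [elem]

@[simp] lemma elem_one (S : Finset ι) (x : ι → ℝ) : elem S 1 x = ∑ i ∈ S, x i := by
  simp [elem, Finset.powersetCard_one]

@[simp] lemma elem_empty_succ (m : ℕ) (x : ι → ℝ) : elem ∅ (m + 1) x = 0 := by
  rw [elem, Finset.powersetCard_eq_empty.2 (by simp), Finset.sum_empty]

lemma elem_congr {S : Finset ι} {x y : ι → ℝ} (h : ∀ i ∈ S, x i = y i) (m : ℕ) :
    elem S m x = elem S m y := by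
  refine Finset.sum_congr rfl fun s hs => Finset.prod_congr rfl fun i hi => h i ?_
  exact (Finset.mem_powersetCard.1 hs).1 hi

/-- The cone where the elementary symmetric functions over `S` of degree at most `m` are
positive. -/
def posCone (S : Finset ι) (m : ℕ) : Set (ι → ℝ) := {x | ∀ j ≤ m, 0 < elem S j x}

lemma posCone_zero (S : Finset ι) : posCone S 0 = Set.univ := by
  ext x; simp [posCone]

lemma posCone_succ (S : Finset ι) (m : ℕ) :
    posCone S (m + 1) = {x ∈ posCone S m | 0 < elem S (m + 1) x / elem S m x} := by
  ext x
  constructor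
  · intro h
    exact ⟨fun j hj => h j (by omega), div_pos (h _ le_rfl) (h _ (by omega))⟩
  · rintro ⟨h, h'⟩ j hj
    rcases Nat.lt_or_ge m j with hj' | hj'
    · obtain rfl : j = m + 1 := by omega
      exact (div_pos_iff_of_pos_right (h m le_rfl)).1 h'
    · exact h j hj'

lemma posCone_anti (S : Finset ι) {l m : ℕ} (h : l ≤ m) : posCone S m ⊆ posCone S l :=
  fun _ hx j hj => hx j (hj.trans h)

lemma elem_div_pos {S : Finset ι} {j m : ℕ} (hj : j < m) {x : ι → ℝ} (hx : x ∈ posCone S m) :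
    0 < elem S (j + 1) x / elem S j x := div_pos (hx _ hj) (hx _ hj.le)

variable [DecidableEq ι]

lemma elem_insert {S : Finset ι} {i : ι} (hi : i ∉ S) (m : ℕ) (x : ι → ℝ) :
    elem (insert i S) (m + 1) x = elem S (m + 1) x + x i * elem S m x := by
  unfold elem
  rw [Finset.powersetCard_succ_insert hi, Finset.sum_union, Finset.sum_image, Finset.mul_sum]
  · congr 1
    refine Finset.sum_congr rfl fun s hs => Finset.prod_insert fun h => hi ?_
    exact (Finset.mem_powersetCard.1 hs).1 h
  · intro s hs t ht hst
    have hs' : i ∉ s := fun h => hi ((Finset.mem_powersetCard.1 hs).1 h)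
    have ht' : i ∉ t := fun h => hi ((Finset.mem_powersetCard.1 ht).1 h)
    rw [← Finset.erase_insert hs', ← Finset.erase_insert ht', hst]
  · rw [Finset.disjoint_left]
    intro s hs hs2
    obtain ⟨t, -, rfl⟩ := Finset.mem_image.1 hs2
    exact hi ((Finset.mem_powersetCard.1 hs).1 (Finset.mem_insert_self i t))

lemma elem_eq_erase {S : Finset ι} {i : ι} (hi : i ∈ S) (m : ℕ) (x : ι → ℝ) :
    elem S (m + 1) x = elem (S.erase i) (m + 1) x + x i * elem (S.erase i) m x := by
  conv_lhs => rw [← Finset.insert_erase hi]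
  exact elem_insert (Finset.notMem_erase i S) m x

lemma sum_mul_elem_erase (S : Finset ι) (m : ℕ) (x : ι → ℝ) :
    ∑ i ∈ S, x i * elem (S.erase i) m x = (m + 1) * elem S (m + 1) x := by
  induction S using Finset.induction_on generalizing m with
  | empty => simp
  | insert a S ha ih =>
    rw [Finset.sum_insert ha, Finset.erase_insert ha, elem_insert ha]
    have hne : ∀ i ∈ S, (insert a S).erase i = insert a (S.erase i) := fun i hi =>
      Finset.erase_insert_of_ne fun h => ha (h ▸ hi)
    have hmem : ∀ i, a ∉ S.erase i := fun i h => ha (Finset.mem_of_mem_erase h)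
    cases m with
    | zero => simp; ring
    | succ m =>
      have : ∑ i ∈ S, x i * elem ((insert a S).erase i) (m + 1) x =
          ∑ i ∈ S, x i * elem (S.erase i) (m + 1) x +
            x a * ∑ i ∈ S, x i * elem (S.erase i) m x := by
        rw [Finset.mul_sum, ← Finset.sum_add_distrib]
        refine Finset.sum_congr rfl fun i hi => ?_
        rw [hne i hi, elem_insert (hmem i)]; ring
      rw [this, ih, ih]; push_cast; ring

open Polynomial in
lemma coeff_prod_one_add_C_mul_X (S : Finset ι) (m : ℕ) (x : ι → ℝ) :
    (∏ i ∈ S, (1 + C (x i) * X)).coeff m = elem S m x := by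
  induction S using Finset.induction_on generalizing m with
  | empty => cases m <;> simp [coeff_one]
  | insert a S ha ih =>
    rw [Finset.prod_insert ha, add_mul, one_mul, coeff_add, ih, mul_assoc, coeff_C_mul]
    cases m with
    | zero => simp
    | succ m => rw [coeff_X_mul, ih, elem_insert ha]

lemma newton_inequality (S : Finset ι) (m : ℕ) (x : ι → ℝ) :
    (m + 2) * (elem S m x * elem S (m + 2) x) ≤ (m + 1) * elem S (m + 1) x ^ 2 := by
  simp only [← coeff_prod_one_add_C_mul_X]
  refine newton_coeff (Polynomial.Splits.prod fun i _ => Polynomial.Splits.of_natDegree_le_one ?_) m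
  compute_degree

lemma elem_mul_le_sq (S : Finset ι) (m : ℕ) (x : ι → ℝ) :
    elem S m x * elem S (m + 2) x ≤ elem S (m + 1) x ^ 2 := by
  have h := newton_inequality S m x
  rcases le_or_gt (elem S m x * elem S (m + 2) x) 0 with h0 | h0
  · exact h0.trans (sq_nonneg _)
  · have : (0 : ℝ) < m + 1 := by positivity
    refine le_of_mul_le_mul_left (le_trans ?_ h) this
    nlinarith

/-- The constant `(m+1)/(m+2) < 1` in Newton's inequality supplies the strictness that later makes
the derivatives strictly positive. -/
lemma elem_mul_lt_sq (S : Finset ι) (m : ℕ) {x : ι → ℝ} (hx : 0 < elem S (m + 1) x) :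
    elem S m x * elem S (m + 2) x < elem S (m + 1) x ^ 2 := by
  have h := newton_inequality S m x
  have h1 : (0 : ℝ) < elem S (m + 1) x ^ 2 := by positivity
  have : (0 : ℝ) < m + 2 := by positivity
  refine lt_of_mul_lt_mul_left (lt_of_le_of_lt h ?_) this.le
  nlinarith

/-- Let `a, b, c` be the functions of degrees `m, m+1, m+2` without `x_i`. If `b ≤ 0`, then `a (c +
x_i b) > 0` and `-b (b + x_i a) ≥ 0` add up to `a c > b²`, against Newton. -/
lemma posCone_erase {S : Finset ι} {i : ι} (hi : i ∈ S) {m : ℕ} {x : ι → ℝ}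
    (hx : x ∈ posCone S (m + 1)) : x ∈ posCone (S.erase i) m := by
  induction m with
  | zero => simp [posCone_zero]
  | succ m ih =>
    have ih' := ih (posCone_anti S (by omega) hx)
    intro j hj
    rcases Nat.lt_or_ge m j with hj' | hj'
    swap
    · exact ih' j hj'
    obtain rfl : j = m + 1 := by omega
    have h0 := ih' m le_rfl
    have h1 := hx (m + 1) (by omega)
    have h2 := hx (m + 1 + 1) le_rfl
    rw [elem_eq_erase hi] at h1 h2
    have hN := elem_mul_le_sq (S.erase i) m x
    by_contra hneg
    have e : m + 1 + 1 = m + 2 := rfl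
    rw [e] at h2
    generalize elem (S.erase i) (m + 1) x = b at *
    generalize elem (S.erase i) m x = a at *
    generalize elem (S.erase i) (m + 2) x = c at *
    push Not at hneg
    nlinarith [mul_pos h0 h2, mul_nonneg (neg_nonneg.2 hneg) h1.le]

/-! ### Concavity and convexity of quotients. -/

lemma convexOn_sq_div {V : Type*} [AddCommGroup V] [Module ℝ V] {D : Set V} {g : V → ℝ}
    (hg : ConcaveOn ℝ D g) (hpos : ∀ x ∈ D, 0 < g x) (f : V →ₗ[ℝ] ℝ) :
    ConvexOn ℝ D fun x => f x ^ 2 / g x := by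
  refine ⟨hg.1, fun x hx y hy s t hs ht hst => ?_⟩
  have hz := hpos _ (hg.1 hx hy hs ht hst)
  have hc := hg.2 hx hy hs ht hst
  have h1 := hpos x hx
  have h2 := hpos y hy
  simp only [map_add, map_smul, smul_eq_mul] at *
  rw [div_le_iff₀ hz]
  -- In terms of the ratios `r, r'` the claim is Cauchy–Schwarz with weights `s g(x)`, `t g(y)`; its
  -- defect is `s t g(x) g(y) (r - r')²`.
  obtain ⟨r, hr⟩ : ∃ r, f x = g x * r := ⟨f x / g x, by field_simp⟩
  obtain ⟨r', hr'⟩ : ∃ r, f y = g y * r := ⟨f y / g y, by field_simp⟩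
  rw [hr, hr']
  have e1 : (g x * r) ^ 2 / g x = g x * r ^ 2 := by field_simp
  have e2 : (g y * r') ^ 2 / g y = g y * r' ^ 2 := by field_simp
  rw [e1, e2]
  have hnn : 0 ≤ s * (g x * r ^ 2) + t * (g y * r' ^ 2) := by positivity
  refine le_trans ?_ (mul_le_mul_of_nonneg_left hc hnn)
  have : 0 ≤ (s * t) * (g x * g y) * (r - r') ^ 2 := by positivity
  nlinarith

lemma concaveOn_elem_div (S : Finset ι) (m : ℕ) :
    ConcaveOn ℝ (posCone S m) fun x => elem S (m + 1) x / elem S m x := by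
  induction m generalizing S with
  | zero =>
    rw [posCone_zero]
    refine ⟨convex_univ, fun x _ y _ s t _ _ _ => le_of_eq ?_⟩
    simp [Finset.mul_sum, Finset.sum_add_distrib]
  | succ m ih =>
    have hD : Convex ℝ (posCone S (m + 1)) := by
      rw [posCone_succ]; exact (ih S).convex_gt 0
    have hterm : ∀ i ∈ S, ConcaveOn ℝ (posCone S (m + 1)) fun x =>
        x i - x i ^ 2 / (x i + elem (S.erase i) (m + 1) x / elem (S.erase i) m x) := by
      intro i hi
      have hlin : ConcaveOn ℝ (posCone S (m + 1)) fun x : ι → ℝ => x i :=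
        (LinearMap.proj (R := ℝ) (φ := fun _ : ι => ℝ) i).concaveOn hD
      refine hlin.sub (convexOn_sq_div (hlin.add ((ih (S.erase i)).subset
        (fun x hx => posCone_erase hi hx) hD)) (fun x hx => ?_) (LinearMap.proj i))
      have h1 := hx (m + 1) le_rfl
      have h0 := posCone_erase hi hx m le_rfl
      rw [elem_eq_erase hi] at h1
      have : x i + elem (S.erase i) (m + 1) x / elem (S.erase i) m x =
        (elem (S.erase i) (m + 1) x + x i * elem (S.erase i) m x) / elem (S.erase i) m x := by
        field_simp; ring
      simp only [Pi.add_apply]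
      rw [this]
      exact div_pos h1 h0
    have hsum : ConcaveOn ℝ (posCone S (m + 1)) fun x => ∑ i ∈ S,
        (x i - x i ^ 2 / (x i + elem (S.erase i) (m + 1) x / elem (S.erase i) m x)) := by
      have := Finset.sum_induction (fun i (x : ι → ℝ) => x i - x i ^ 2 /
        (x i + elem (S.erase i) (m + 1) x / elem (S.erase i) m x))
        (fun f => ConcaveOn ℝ (posCone S (m + 1)) f) (fun _ _ h h' => h.add h')
        (concaveOn_const 0 hD) hterm
      convert this using 2 with x
      simp
    refine (hsum.smul (c := ((m : ℝ) + 2)⁻¹) (by positivity)).congr fun x hx => ?_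
    have hm : (m : ℝ) + 2 ≠ 0 := by positivity
    have hp := hx (m + 1) le_rfl
    simp only [smul_eq_mul]
    -- Euler's identity `sum_mul_elem_erase` splits the quotient into the terms `x_i b / (b + x_i
    -- a)`, each equal to `x_i - x_i² / (x_i + b/a)`.
    rw [inv_mul_eq_iff_eq_mul₀ hm, ← mul_div_assoc]
    have hid := sum_mul_elem_erase S (m + 1) x
    push_cast at hid
    rw [show (m : ℝ) + 2 = m + 1 + 1 by ring, ← hid, Finset.sum_div]
    refine Finset.sum_congr rfl fun i hi => ?_
    have h0 := posCone_erase hi hx m le_rfl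
    rw [elem_eq_erase hi m] at hp ⊢
    generalize elem (S.erase i) (m + 1) x = b at *
    generalize elem (S.erase i) m x = a at *
    have : x i + b / a = (b + x i * a) / a := by field_simp; ring
    rw [this]
    field_simp
    ring

lemma convex_posCone (S : Finset ι) (m : ℕ) : Convex ℝ (posCone S m) :=
  (concaveOn_elem_div S m).1

lemma convexOn_log_elem_div {S : Finset ι} {l d : ℕ} :
    ConvexOn ℝ (posCone S (l + d)) fun x => Real.log (elem S l x / elem S (l + d) x) := by
  induction d with
  | zero =>
    refine (convexOn_const 0 (convex_posCone S _)).congr fun x hx => ?_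
    simp [(hx l le_rfl).ne']
  | succ d ih =>
    have hc : ConvexOn ℝ (posCone S (l + d + 1)) fun x =>
        - Real.log (elem S (l + d + 1) x / elem S (l + d) x) := by
      have hsub := posCone_anti S (show l + d ≤ l + d + 1 by omega)
      have hD := convex_posCone S (l + d + 1)
      have hq := (concaveOn_elem_div S (l + d)).subset hsub hD
      refine (ConcaveOn.neg ?_)
      refine ⟨hD, fun x hx y hy s t hs ht hst => ?_⟩
      have h1 := elem_div_pos (show l + d < l + d + 1 by omega) hx
      have h2 := elem_div_pos (show l + d < l + d + 1 by omega) hy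
      have := strictConcaveOn_log_Ioi.concaveOn.2 h1 h2 hs ht hst
      refine this.trans (Real.log_le_log ?_ (hq.2 hx hy hs ht hst))
      exact (convex_Ioi (0 : ℝ)) h1 h2 hs ht hst
    refine ((ih.subset (posCone_anti S (show l + d ≤ l + d + 1 by omega))
      (convex_posCone S _)).add hc).congr fun x hx => ?_
    have h0 := (hx l (by omega)).ne'
    have h1 := (hx (l + d) (by omega)).ne'
    have h2 := (hx (l + d + 1) (by omega)).ne'
    simp only [Pi.add_apply]
    rw [← Real.log_inv, ← Real.log_mul (div_ne_zero h0 h1) (inv_ne_zero (div_ne_zero h2 h1))]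
    congr 1
    rw [← add_assoc]
    field_simp

lemma convexOn_elem_div {S : Finset ι} {l m : ℕ} (hl : l ≤ m) :
    ConvexOn ℝ (posCone S m) fun x => elem S l x / elem S m x := by
  obtain ⟨d, rfl⟩ := Nat.exists_eq_add_of_le hl
  have h := convexOn_log_elem_div (S := S) (l := l) (d := d)
  have hexp : ConvexOn ℝ (posCone S (l + d)) fun x =>
      Real.exp (Real.log (elem S l x / elem S (l + d) x)) := by
    refine ⟨h.1, fun x hx y hy s t hs ht hst => ?_⟩
    exact (Real.exp_le_exp.2 (h.2 hx hy hs ht hst)).trans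
      (convexOn_exp.2 (Set.mem_univ _) (Set.mem_univ _) hs ht hst)
  refine hexp.congr fun x hx => ?_
  exact Real.exp_log (div_pos (hx _ (by omega)) (hx _ le_rfl))

/-! ### Monotonicity of the quotients in each variable. -/

lemma elem_mul_lt_elem_mul {S : Finset ι} {l m : ℕ} (hl : l < m) {x : ι → ℝ}
    (hx : x ∈ posCone S m) : elem S l x * elem S (m + 1) x < elem S (l + 1) x * elem S m x := by
  obtain ⟨d, rfl⟩ := Nat.exists_eq_add_of_le hl
  clear hl
  induction d with
  | zero =>
    have := elem_mul_lt_sq S l (hx (l + 1) le_rfl)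
    simp only [add_zero, Nat.succ_eq_add_one] at *
    linarith [this, sq (elem S (l + 1) x)]
  | succ d ih =>
    have h1 := ih (posCone_anti S (by omega) hx)
    have ha := hx l (by omega)
    have hb := hx (l + 1) (by omega)
    have hc := hx (l.succ + d) (by omega)
    have hd := hx (l.succ + d + 1) le_rfl
    have h2 := elem_mul_lt_sq S (l.succ + d) hd
    have e : l.succ + (d + 1) = l.succ + d + 1 := rfl
    have e2 : l.succ + d + 1 + 1 = l.succ + d + 2 := rfl
    rw [e, e2]
    generalize elem S l x = a at *
    generalize elem S (l + 1) x = b at *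
    generalize elem S (l.succ + d) x = c at *
    generalize elem S (l.succ + d + 1) x = p at *
    generalize elem S (l.succ + d + 2) x = q at *
    -- Successive ratios decrease strictly: `c a q < a p² < c b p`, by Newton and by the induction
    -- hypothesis `a p < b c`.
    refine lt_of_mul_lt_mul_left (a := c) ?_ hc.le
    nlinarith [mul_lt_mul_of_pos_left h2 ha, mul_lt_mul_of_pos_left h1 hd]

lemma hasDerivAt_elem_succ {S : Finset ι} {i : ι} (hi : i ∈ S) (m : ℕ) (x : ι → ℝ) :
    HasDerivAt (fun t : ℝ => elem S (m + 1) (x + t • Pi.single i 1)) (elem (S.erase i) m x) 0 := by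
  have h : ∀ t : ℝ, elem S (m + 1) (x + t • Pi.single i 1) =
      elem (S.erase i) (m + 1) x + (x i + t) * elem (S.erase i) m x := by
    intro t
    have hc : ∀ j ∈ S.erase i, (x + t • Pi.single i (1 : ℝ) : ι → ℝ) j = x j := fun j hj => by
      simp [Finset.ne_of_mem_erase hj]
    rw [elem_eq_erase hi, elem_congr hc, elem_congr hc]
    simp
  simp only [h]
  simpa using (((hasDerivAt_id (0 : ℝ)).const_add (x i)).mul_const
    (elem (S.erase i) m x)).const_add (elem (S.erase i) (m + 1) x)

/-- Numerator and denominator are affine in `x_i`, so the terms containing `x_i` cancel in the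
quotient rule. The sign is then a Newton-type comparison in the other variables. -/
lemma hasDerivAt_elem_succ_div {S : Finset ι} {i : ι} (hi : i ∈ S) (j m : ℕ) {x : ι → ℝ}
    (hx : elem S (m + 1) x ≠ 0) :
    HasDerivAt (fun t : ℝ => elem S (j + 1) (x + t • Pi.single i 1) /
        elem S (m + 1) (x + t • Pi.single i 1))
      ((elem (S.erase i) j x * elem (S.erase i) (m + 1) x -
        elem (S.erase i) (j + 1) x * elem (S.erase i) m x) / elem S (m + 1) x ^ 2) 0 := by
  refine ((hasDerivAt_elem_succ hi j x).fun_div (hasDerivAt_elem_succ hi m x) (by simpa)).congr_deriv ?_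
  rw [zero_smul, add_zero]
  rw [elem_eq_erase hi j, elem_eq_erase hi m]
  ring

lemma hasDerivAt_elem_zero_div {S : Finset ι} {i : ι} (hi : i ∈ S) (m : ℕ) {x : ι → ℝ}
    (hx : elem S (m + 1) x ≠ 0) :
    HasDerivAt (fun t : ℝ => elem S 0 (x + t • Pi.single i 1) /
        elem S (m + 1) (x + t • Pi.single i 1))
      (- elem (S.erase i) m x / elem S (m + 1) x ^ 2) 0 := by
  simpa using (hasDerivAt_elem_succ hi m x).fun_inv (by simpa)

lemma exists_hasDerivAt_elem_div_neg {S : Finset ι} {i : ι} (hi : i ∈ S) {l m : ℕ} (hl : l ≤ m)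
    {x : ι → ℝ} (hx : x ∈ posCone S (m + 1)) :
    ∃ c < 0, HasDerivAt (fun t : ℝ => elem S l (x + t • Pi.single i 1) /
        elem S (m + 1) (x + t • Pi.single i 1)) c 0 := by
  have hD := hx (m + 1) le_rfl
  have he := posCone_erase hi hx
  cases l with
  | zero =>
    exact ⟨_, div_neg_of_neg_of_pos (neg_lt_zero.2 (he m le_rfl)) (by positivity),
      hasDerivAt_elem_zero_div hi m hD.ne'⟩
  | succ j =>
    exact ⟨_, div_neg_of_neg_of_pos (sub_neg.2 (elem_mul_lt_elem_mul hl he)) (by positivity),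
      hasDerivAt_elem_succ_div hi j m hD.ne'⟩

lemma exists_hasDerivAt_elem_div_nonneg {S : Finset ι} {i : ι} (hi : i ∈ S) {m : ℕ}
    {x : ι → ℝ} (hx : x ∈ posCone S (m + 1)) :
    ∃ c ≥ 0, HasDerivAt (fun t : ℝ => elem S (m + 2) (x + t • Pi.single i 1) /
        elem S (m + 1) (x + t • Pi.single i 1)) c 0 := by
  refine ⟨_, div_nonneg (sub_nonneg.2 ?_) (sq_nonneg _),
    hasDerivAt_elem_succ_div hi (m + 1) m (hx (m + 1) le_rfl).ne'⟩
  have := elem_mul_le_sq (S.erase i) m x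
  linarith [sq (elem (S.erase i) (m + 1) x)]

/-! ### The function `G` on the cone of eigenvalues. -/

variable {n : ℕ}

lemma sigma_eq_elem (m : ℕ) (lam : Fin n → ℝ) : sigma m lam = elem Finset.univ m lam := rfl

lemma Gam_eq_posCone (m : ℕ) : Gam n m = posCone Finset.univ m := by
  ext x
  refine ⟨fun h j hj => ?_, fun h j _ hj => h j hj⟩
  rcases Nat.eq_zero_or_pos j with rfl | h0
  · simp
  · exact h j h0 hj

lemma differentiable_sigma (m : ℕ) : Differentiable ℝ (sigma (n := n) m) := by
  unfold sigma; fun_prop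

lemma sigma_pos_of_mem_Gam {m : ℕ} {x : Fin n → ℝ} (hx : x ∈ Gam n m) : 0 < sigma m x := by
  rw [Gam_eq_posCone] at hx
  exact hx m le_rfl

lemma differentiableAt_G {k : ℕ} (a : ℕ → ℝ) {x : Fin n → ℝ} (hx : sigma (k - 1) x ≠ 0) :
    DifferentiableAt ℝ (G (n := n) k a) x := by
  have hq : ∀ l, DifferentiableAt ℝ (fun y : Fin n → ℝ => sigma l y / sigma (k - 1) y) x := by
    intro l
    simp only [div_eq_mul_inv]
    exact (differentiable_sigma l x).mul ((differentiable_sigma _ x).inv hx)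
  exact (hq k).sub (DifferentiableAt.fun_sum fun l _ => (hq l).const_mul _)

lemma concaveOn_G {k : ℕ} (hk : 1 ≤ k) {a : ℕ → ℝ} (ha : ∀ l < k - 1, 0 ≤ a l) :
    ConcaveOn ℝ (Gam n (k - 1)) (G (n := n) k a) := by
  obtain ⟨m, rfl⟩ := Nat.exists_eq_add_of_le' hk
  rw [Nat.add_sub_cancel] at *
  rw [Gam_eq_posCone]
  refine (concaveOn_elem_div Finset.univ m).sub ?_
  have := Finset.sum_induction (s := Finset.range m)
    (fun l (x : Fin n → ℝ) => a l * (sigma l x / sigma m x))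
    (fun f => ConvexOn ℝ (posCone Finset.univ m) f) (fun _ _ h h' => h.add h')
    (convexOn_const 0 (convex_posCone _ _)) (fun l hl => by
      have hl := Finset.mem_range.1 hl
      exact (convexOn_elem_div hl.le).smul (ha l hl))
  refine this.congr fun x _ => ?_
  simp [Finset.sum_apply]

lemma fderiv_G_single {k : ℕ} (hk : 2 ≤ k) {a : ℕ → ℝ} (ha : ∀ l < k - 1, 0 ≤ a l)
    {x : Fin n → ℝ} (hx : x ∈ Gam n (k - 1)) (i : Fin n) :
    0 ≤ fderiv ℝ (G (n := n) k a) x (Pi.single i 1) ∧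
      (0 < ∑ l ∈ Finset.range (k - 1), a l →
        0 < fderiv ℝ (G (n := n) k a) x (Pi.single i 1)) := by
  obtain ⟨m, rfl⟩ := Nat.exists_eq_add_of_le' hk
  have e : m + 2 - 1 = m + 1 := rfl
  have hdiff := differentiableAt_G a (sigma_pos_of_mem_Gam hx).ne'
  rw [e] at *
  rw [Gam_eq_posCone] at hx
  obtain ⟨c, hc, hder⟩ := exists_hasDerivAt_elem_div_nonneg (Finset.mem_univ i) hx
  -- The bound on `l` is placed inside the existential, with a dummy value beyond it, so that
  -- `choose` gives a function of `l` alone.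
  have hneg : ∀ l, ∃ d, l < m + 1 → d < 0 ∧
      HasDerivAt (fun t : ℝ => elem Finset.univ l (x + t • Pi.single i 1) /
        elem Finset.univ (m + 1) (x + t • Pi.single i 1)) d 0 := fun l => by
    by_cases hl : l < m + 1
    · obtain ⟨d, h1, h2⟩ := exists_hasDerivAt_elem_div_neg (Finset.mem_univ i)
        (Nat.lt_succ_iff.1 hl) hx
      exact ⟨d, fun _ => ⟨h1, h2⟩⟩
    · exact ⟨0, fun h => absurd h hl⟩
  choose d hd using hneg
  have hG : HasDerivAt (fun t : ℝ => G (m + 2) a (x + t • Pi.single i 1))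
      (c - ∑ l ∈ Finset.range (m + 1), a l * d l) 0 :=
    hder.fun_sub (HasDerivAt.fun_sum fun l hl =>
      ((hd l (Finset.mem_range.1 hl)).2.const_mul (a l)))
  have hval : fderiv ℝ (G (n := n) (m + 2) a) x (Pi.single i 1) =
      c - ∑ l ∈ Finset.range (m + 1), a l * d l := by
    rw [← hdiff.lineDeriv_eq_fderiv]
    exact hG.deriv
  have hterm : ∀ l ∈ Finset.range (m + 1), a l * d l ≤ 0 := fun l hl =>
    mul_nonpos_of_nonneg_of_nonpos (ha l (Finset.mem_range.1 hl)) (hd l (Finset.mem_range.1 hl)).1.le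
  rw [hval]
  refine ⟨sub_nonneg.2 ((Finset.sum_nonpos hterm).trans hc), fun hpos => ?_⟩
  obtain ⟨l, hl, hal⟩ := Finset.exists_lt_of_sum_lt (s := Finset.range (m + 1))
    (f := fun _ => (0 : ℝ)) (g := a) (by simpa using hpos)
  have : ∑ l ∈ Finset.range (m + 1), a l * d l < 0 :=
    Finset.sum_neg' hterm ⟨l, hl, mul_neg_of_pos_of_neg hal (hd l (Finset.mem_range.1 hl)).1⟩
  linarith [show 0 ≤ c from hc]

/-! ### From symmetric functions of eigenvalues to matrices: Schur and Birkhoff. -/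

open Matrix

lemma sigma_comp_perm (m : ℕ) (x : Fin n → ℝ) (e : Equiv.Perm (Fin n)) :
    sigma m (x ∘ e) = sigma m x := by
  simp only [sigma_eq_elem, ← coeff_prod_one_add_C_mul_X]
  congr 1
  exact Equiv.prod_comp e fun i => 1 + Polynomial.C (x i) * Polynomial.X

lemma comp_perm_mem_Gam {m : ℕ} {x : Fin n → ℝ} (hx : x ∈ Gam n m) (e : Equiv.Perm (Fin n)) :
    x ∘ e ∈ Gam n m := fun j h1 h2 => by
  rw [sigma_comp_perm]; exact hx j h1 h2

lemma G_comp_perm (k : ℕ) (a : ℕ → ℝ) (x : Fin n → ℝ) (e : Equiv.Perm (Fin n)) :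
    G k a (x ∘ e) = G k a x := by
  simp only [G, sigma_comp_perm]

section Majorization

variable {D : Set (Fin n → ℝ)} {f : (Fin n → ℝ) → ℝ}

/-- The superlevel set of `f` at height `f x` is convex and contains every permutation of `x`; by
Birkhoff `S *ᵥ x` is a convex combination of these. -/
lemma le_apply_doublyStochastic_mulVec (hf : ConcaveOn ℝ D f)
    (hD : ∀ x ∈ D, ∀ e : Equiv.Perm (Fin n), x ∘ e ∈ D)
    (hfe : ∀ x, ∀ e : Equiv.Perm (Fin n), f (x ∘ e) = f x)
    {S : Matrix (Fin n) (Fin n) ℝ} (hS : S ∈ doublyStochastic ℝ (Fin n)) {x : Fin n → ℝ}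
    (hx : x ∈ D) : S *ᵥ x ∈ D ∧ f x ≤ f (S *ᵥ x) := by
  have hconv : Convex ℝ {S : Matrix (Fin n) (Fin n) ℝ | S *ᵥ x ∈ {y ∈ D | f x ≤ f y}} := by
    intro S hS T hT s t hs ht hst
    simp only [Set.mem_ofPred_eq, add_mulVec, smul_mulVec] at *
    exact (hf.convex_ge (f x)) hS hT hs ht hst
  rw [← SetLike.mem_coe, doublyStochastic_eq_convexHull_permMatrix] at hS
  refine convexHull_min ?_ hconv hS
  rintro _ ⟨e, rfl⟩
  simp only [Set.mem_ofPred_eq, permMatrix_mulVec]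
  exact ⟨hD x hx e, (hfe x e).ge⟩

lemma exists_orthogonal_diagonalization {A : Matrix (Fin n) (Fin n) ℝ} (hA : A.IsSymm) :
    ∃ Q : Matrix (Fin n) (Fin n) ℝ, Qᵀ * Q = 1 ∧ Q * Qᵀ = 1 ∧
      A = Q * diagonal (eigenvals A) * Qᵀ := by
  have h : A.IsHermitian := by rwa [IsHermitian, conjTranspose_eq_transpose_of_trivial]
  have hs : star (h.eigenvectorUnitary : Matrix (Fin n) (Fin n) ℝ) =
      (h.eigenvectorUnitary : Matrix (Fin n) (Fin n) ℝ)ᵀ := by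
    rw [star_eq_conjTranspose, conjTranspose_eq_transpose_of_trivial]
  refine ⟨h.eigenvectorUnitary, ?_, ?_, ?_⟩
  · rw [← hs]; exact Unitary.coe_star_mul_self _
  · rw [← hs]; exact Unitary.coe_mul_star_self _
  · rw [← hs]
    conv_lhs => rw [h.spectral_theorem]
    rw [Unitary.conjStarAlgAut_apply]
    simp only [eigenvals, h, dite_true]
    rfl

lemma sq_entries_mem_doublyStochastic {V : Matrix (Fin n) (Fin n) ℝ} (h1 : Vᵀ * V = 1)
    (h2 : V * Vᵀ = 1) : Matrix.of (fun i j => V i j ^ 2) ∈ doublyStochastic ℝ (Fin n) := by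
  rw [mem_doublyStochastic_iff_sum]
  refine ⟨fun i j => sq_nonneg _, fun i => ?_, fun j => ?_⟩
  · have := congrFun (congrFun h2 i) i
    simpa [mul_apply, sq] using this
  · have := congrFun (congrFun h1 j) j
    simpa [mul_apply, sq] using this

/-- The diagonal of the matrix `A` in the basis given by the columns of `Q`. -/
def diagIn (Q A : Matrix (Fin n) (Fin n) ℝ) : Fin n → ℝ := (Qᵀ * A * Q).diag

lemma diagIn_add (Q A B : Matrix (Fin n) (Fin n) ℝ) :
    diagIn Q (A + B) = diagIn Q A + diagIn Q B := by
  simp [diagIn, mul_add, add_mul]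

lemma diagIn_smul (Q : Matrix (Fin n) (Fin n) ℝ) (t : ℝ) (A : Matrix (Fin n) (Fin n) ℝ) :
    diagIn Q (t • A) = t • diagIn Q A := by
  simp [diagIn]

lemma diagIn_self {Q A : Matrix (Fin n) (Fin n) ℝ} (h1 : Qᵀ * Q = 1)
    (hA : A = Q * diagonal (eigenvals A) * Qᵀ) : diagIn Q A = eigenvals A := by
  have : Qᵀ * A * Q = (Qᵀ * Q) * diagonal (eigenvals A) * (Qᵀ * Q) := by
    conv_lhs => rw [hA]
    simp only [mul_assoc]
  rw [diagIn, this, h1, one_mul, mul_one]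
  simp

/-- Schur: if `U` diagonalizes `A`, the weights are the squared entries of the orthogonal matrix `Qᵀ
U`. -/
lemma exists_doublyStochastic_diagIn {Q A : Matrix (Fin n) (Fin n) ℝ} (h1 : Qᵀ * Q = 1)
    (h2 : Q * Qᵀ = 1) (hA : A.IsSymm) :
    ∃ S ∈ doublyStochastic ℝ (Fin n), diagIn Q A = S *ᵥ eigenvals A := by
  obtain ⟨U, hU1, hU2, hU⟩ := exists_orthogonal_diagonalization hA
  have hV1 : (Qᵀ * U)ᵀ * (Qᵀ * U) = 1 := by
    rw [transpose_mul, transpose_transpose, mul_assoc, ← mul_assoc Q, h2, one_mul, hU1]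
  have hV2 : (Qᵀ * U) * (Qᵀ * U)ᵀ = 1 := by
    rw [transpose_mul, transpose_transpose, mul_assoc, ← mul_assoc U, hU2, one_mul, h1]
  refine ⟨_, sq_entries_mem_doublyStochastic hV1 hV2, ?_⟩
  have : Qᵀ * A * Q = (Qᵀ * U) * diagonal (eigenvals A) * (Qᵀ * U)ᵀ := by
    conv_lhs => rw [hU]
    simp only [transpose_mul, transpose_transpose, mul_assoc]
  ext i
  rw [diagIn, this, diag_apply, mul_apply]
  simp only [mul_diagonal, mulVec, dotProduct, transpose_apply, of_apply]
  exact Finset.sum_congr rfl fun j _ => by ring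

lemma le_apply_diagIn (hf : ConcaveOn ℝ D f)
    (hD : ∀ x ∈ D, ∀ e : Equiv.Perm (Fin n), x ∘ e ∈ D)
    (hfe : ∀ x, ∀ e : Equiv.Perm (Fin n), f (x ∘ e) = f x)
    {Q A : Matrix (Fin n) (Fin n) ℝ} (h1 : Qᵀ * Q = 1) (h2 : Q * Qᵀ = 1) (hA : A.IsSymm)
    (hx : eigenvals A ∈ D) : diagIn Q A ∈ D ∧ f (eigenvals A) ≤ f (diagIn Q A) := by
  obtain ⟨S, hS, h⟩ := exists_doublyStochastic_diagIn h1 h2 hA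
  rw [h]
  exact le_apply_doublyStochastic_mulVec hf hD hfe hS hx

/-- In an eigenbasis of `s A + t B`, its eigenvalues are the same combination of the diagonals of
`A` and `B`, so concavity of `f` applies to the diagonals. -/
lemma concaveOn_comp_eigenvals (hf : ConcaveOn ℝ D f)
    (hD : ∀ x ∈ D, ∀ e : Equiv.Perm (Fin n), x ∘ e ∈ D)
    (hfe : ∀ x, ∀ e : Equiv.Perm (Fin n), f (x ∘ e) = f x) :
    ConcaveOn ℝ {A : Matrix (Fin n) (Fin n) ℝ | A.IsSymm ∧ eigenvals A ∈ D}
      fun A => f (eigenvals A) := by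
  have key : ∀ A : Matrix (Fin n) (Fin n) ℝ, A.IsSymm ∧ eigenvals A ∈ D →
      ∀ B : Matrix (Fin n) (Fin n) ℝ, B.IsSymm ∧ eigenvals B ∈ D → ∀ s t : ℝ, 0 ≤ s → 0 ≤ t →
      s + t = 1 → (s • A + t • B).IsSymm ∧ eigenvals (s • A + t • B) ∈ D ∧
        s * f (eigenvals A) + t * f (eigenvals B) ≤ f (eigenvals (s • A + t • B)) := by
    rintro A ⟨hA, hA'⟩ B ⟨hB, hB'⟩ s t hs ht hst
    have hC : (s • A + t • B).IsSymm := (hA.smul s).add (hB.smul t)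
    obtain ⟨Q, h1, h2, h3⟩ := exists_orthogonal_diagonalization hC
    have hd := diagIn_self h1 h3
    rw [diagIn_add, diagIn_smul, diagIn_smul] at hd
    have hAd := le_apply_diagIn hf hD hfe h1 h2 hA hA'
    have hBd := le_apply_diagIn hf hD hfe h1 h2 hB hB'
    rw [← hd]
    refine ⟨hC, hf.1 hAd.1 hBd.1 hs ht hst, le_trans ?_ (hf.2 hAd.1 hBd.1 hs ht hst)⟩
    simp only [smul_eq_mul]
    exact add_le_add (mul_le_mul_of_nonneg_left hAd.2 hs) (mul_le_mul_of_nonneg_left hBd.2 ht)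
  refine ⟨fun A hA B hB s t hs ht hst => ?_, fun A hA B hB s t hs ht hst => ?_⟩
  · exact ⟨(key A hA B hB s t hs ht hst).1, (key A hA B hB s t hs ht hst).2.1⟩
  · exact (key A hA B hB s t hs ht hst).2.2

end Majorization

/-! ### Differentiation along lines of symmetric matrices. -/

lemma sigma_eigenvals {A : Matrix (Fin n) (Fin n) ℝ} (hA : A.IsSymm) {m : ℕ} (hm : m ≤ n) :
    sigma m (eigenvals A) = (-1) ^ m * A.charpoly.coeff (n - m) := by
  have h : A.IsHermitian := by rwa [IsHermitian, conjTranspose_eq_transpose_of_trivial]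
  have hv := Multiset.prod_X_sub_C_coeff (Finset.univ.val.map (eigenvals A)) (k := n - m) (by simp)
  rw [Multiset.map_map, Multiset.card_map, Finset.card_val, Finset.card_univ, Fintype.card_fin,
    Finset.esymm_map_val, Nat.sub_sub_self hm] at hv
  have hc : A.charpoly = (Finset.univ.val.map
      ((fun t => Polynomial.X - Polynomial.C t) ∘ eigenvals A)).prod := by
    rw [h.charpoly_eq]
    simp only [eigenvals, h, dite_true]
    rfl
  rw [hc, hv, ← mul_assoc, ← mul_pow]
  simp [sigma]

open Polynomial in
-- Ordered eigenvalues may fail to be differentiable where they cross, but their symmetric functions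
-- are, up to sign, coefficients of the characteristic polynomial, hence polynomial in `t`.
lemma exists_polynomial_sigma_eigenvals (A B : Matrix (Fin n) (Fin n) ℝ) (hA : A.IsSymm)
    (hB : B.IsSymm) (m : ℕ) : ∃ p : ℝ[X], ∀ t : ℝ, sigma m (eigenvals (A + t • B)) = p.eval t := by
  rcases le_or_gt m n with hm | hm
  · let M : Matrix (Fin n) (Fin n) ℝ[X] := of fun i j => C (A i j) + X * C (B i j)
    refine ⟨(-1) ^ m * M.charpoly.coeff (n - m), fun t => ?_⟩
    have hM : A + t • B = M.map (evalRingHom t) := by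
      ext i j
      simp only [M, Matrix.add_apply, Matrix.smul_apply, Matrix.map_apply, of_apply, smul_eq_mul,
        coe_evalRingHom, eval_add, eval_mul, eval_C, eval_X]
    rw [sigma_eigenvals (hA.add (hB.smul t)) hm, hM, charpoly_map, coeff_map]
    simp
  · refine ⟨0, fun t => ?_⟩
    rw [sigma, Finset.powersetCard_eq_empty.2 (by simpa using hm)]
    simp

lemma differentiable_sigma_eigenvals {A B : Matrix (Fin n) (Fin n) ℝ} (hA : A.IsSymm)
    (hB : B.IsSymm) (m : ℕ) :
    Differentiable ℝ fun t : ℝ => sigma m (eigenvals (A + t • B)) := by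
  obtain ⟨p, hp⟩ := exists_polynomial_sigma_eigenvals A B hA hB m
  simp only [hp]
  exact p.differentiable

lemma concaveOn_G_eigenvals {k : ℕ} (hk : 1 ≤ k) {a : ℕ → ℝ} (ha : ∀ l < k - 1, 0 ≤ a l) :
    ConcaveOn ℝ (MatGam n (k - 1)) fun A => G k a (eigenvals A) :=
  concaveOn_comp_eigenvals (concaveOn_G hk ha) (fun _ hx e => comp_perm_mem_Gam hx e)
    (G_comp_perm k a)

lemma eventually_mem_MatGam {m : ℕ} {A B : Matrix (Fin n) (Fin n) ℝ} (hA : A ∈ MatGam n m)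
    (hB : B.IsSymm) : ∀ᶠ t : ℝ in nhds 0, A + t • B ∈ MatGam n m := by
  have h : ∀ᶠ t : ℝ in nhds 0, ∀ j ∈ Finset.Icc 1 m, 0 < sigma j (eigenvals (A + t • B)) := by
    rw [Filter.eventually_all_finset]
    intro j hj
    obtain ⟨h1, h2⟩ := Finset.mem_Icc.1 hj
    have hc := (differentiable_sigma_eigenvals hA.1 hB j).continuous.continuousAt (x := 0)
    exact hc.eventually (lt_mem_nhds (by simpa using hA.2 j h1 h2))
  filter_upwards [h] with t ht
  exact ⟨hA.1.add (hB.smul t), fun j h1 h2 => ht j (Finset.mem_Icc.2 ⟨h1, h2⟩)⟩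

/-- Both `G (λ(A) + t diag B)` and `G (λ(A + tB))` are differentiable at `0`, where they agree; the
first dominates the second nearby, so their difference has a minimum and the derivatives coincide.
-/
lemma hasDerivAt_G_eigenvals {k : ℕ} (hk : 1 ≤ k) {a : ℕ → ℝ} (ha : ∀ l < k - 1, 0 ≤ a l)
    {A B Q : Matrix (Fin n) (Fin n) ℝ} (hA : A ∈ MatGam n (k - 1)) (hB : B.IsSymm)
    (h1 : Qᵀ * Q = 1) (h2 : Q * Qᵀ = 1) (hQ : A = Q * diagonal (eigenvals A) * Qᵀ) :
    HasDerivAt (fun t : ℝ => G k a (eigenvals (A + t • B)))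
      (fderiv ℝ (G (n := n) k a) (eigenvals A) (diagIn Q B)) 0 := by
  have hpos := sigma_pos_of_mem_Gam hA.2
  have hg : DifferentiableAt ℝ (fun t : ℝ => G k a (eigenvals (A + t • B))) 0 := by
    have hd := fun m => (differentiable_sigma_eigenvals hA.1 hB m).differentiableAt (x := 0)
    have hne : sigma (k - 1) (eigenvals (A + (0 : ℝ) • B)) ≠ 0 := by simpa using hpos.ne'
    exact ((hd k).fun_div (hd _) hne).fun_sub
      (DifferentiableAt.fun_sum fun l _ => ((hd l).fun_div (hd _) hne).const_mul _)
  have hh : HasDerivAt (fun t : ℝ => G k a (eigenvals A + t • diagIn Q B))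
      (fderiv ℝ (G (n := n) k a) (eigenvals A) (diagIn Q B)) 0 := by
    have hdiff := differentiableAt_G a hpos.ne'
    exact hdiff.hasFDerivAt.hasLineDerivAt (diagIn Q B)
  have hmin : IsLocalMin (fun t : ℝ => G k a (eigenvals A + t • diagIn Q B) -
      G k a (eigenvals (A + t • B))) 0 := by
    filter_upwards [eventually_mem_MatGam hA hB] with t ht
    have := (le_apply_diagIn (concaveOn_G hk ha) (fun _ hx e => comp_perm_mem_Gam hx e)
      (G_comp_perm k a) h1 h2 ht.1 ht.2).2
    rw [diagIn_add, diagIn_smul, diagIn_self h1 hQ] at this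
    simpa using this
  have hz := hmin.hasDerivAt_eq_zero (hh.fun_sub hg.hasDerivAt)
  rw [sub_eq_zero.1 hz]
  exact hg.hasDerivAt

lemma sum_mul_diagIn (Q B : Matrix (Fin n) (Fin n) ℝ) (d : Fin n → ℝ) :
    ∑ l, d l * diagIn Q B l = ∑ i, ∑ j, (Q * diagonal d * Qᵀ) i j * B i j := by
  have hl : ∀ l, d l * diagIn Q B l = ∑ i, ∑ j, Q i l * d l * Q j l * B i j := by
    intro l
    rw [diagIn, diag_apply, mul_apply, Finset.sum_comm, Finset.mul_sum]
    refine Finset.sum_congr rfl fun j _ => ?_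
    rw [mul_apply, Finset.sum_mul, Finset.mul_sum]
    exact Finset.sum_congr rfl fun i _ => by rw [transpose_apply]; ring
  have hr : ∀ i j, (Q * diagonal d * Qᵀ) i j * B i j = ∑ l, Q i l * d l * Q j l * B i j := by
    intro i j
    rw [mul_apply, Finset.sum_mul]
    simp only [mul_diagonal, transpose_apply]
  simp only [hl, hr]
  rw [Finset.sum_comm]
  exact Finset.sum_congr rfl fun i _ => Finset.sum_comm

lemma exists_linearization {k : ℕ} (hk : 2 ≤ k) {a : ℕ → ℝ} (ha : ∀ l < k - 1, 0 ≤ a l)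
    {A : Matrix (Fin n) (Fin n) ℝ} (hA : A ∈ MatGam n (k - 1)) :
    ∃ P : Matrix (Fin n) (Fin n) ℝ,
      P.PosSemidef ∧ (0 < ∑ l ∈ Finset.range (k - 1), a l → P.PosDef) ∧
      ∀ B : Matrix (Fin n) (Fin n) ℝ, B.IsSymm →
        HasDerivAt (fun t : ℝ => G k a (eigenvals (A + t • B))) (∑ i, ∑ j, P i j * B i j) 0 := by
  obtain ⟨Q, h1, h2, hQ⟩ := exists_orthogonal_diagonalization hA.1
  have hder := fun i => fderiv_G_single hk ha hA.2 i
  have hstar : star Q = Qᵀ := by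
    rw [star_eq_conjTranspose, conjTranspose_eq_transpose_of_trivial]
  have hU : IsUnit Q := ⟨⟨Q, Qᵀ, h2, h1⟩, rfl⟩
  refine ⟨Q * diagonal (fun i => fderiv ℝ (G (n := n) k a) (eigenvals A) (Pi.single i 1)) * Qᵀ,
    ?_, fun hpos => ?_, fun B hB => ?_⟩
  · rw [← hstar, hU.posSemidef_star_right_conjugate_iff, posSemidef_diagonal_iff]
    exact fun i => (hder i).1
  · rw [← hstar, hU.posDef_star_right_conjugate_iff, posDef_diagonal_iff]
    exact fun i => (hder i).2 hpos
  · rw [← sum_mul_diagIn]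
    refine (hasDerivAt_G_eigenvals (by omega) ha hA hB h1 h2 hQ).congr_deriv ?_
    conv_lhs => rw [pi_eq_sum_univ' (diagIn Q B), map_sum]
    simp [mul_comm]

/-! ### Symmetry and linearity of second derivatives and Euclidean Hessians. -/

section SecondDerivative

variable {E : Type*} [NormedAddCommGroup E] [NormedSpace ℝ E] {u v : E → ℝ} {x : E}

lemma differentiableAt_fderiv_of_contDiffAt_two (hu : ContDiffAt ℝ 2 u x) :
    DifferentiableAt ℝ (fderiv ℝ u) x :=
  (hu.fderiv_right (m := 1) (by norm_num)).differentiableAt (by norm_num)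

lemma fderiv_fderiv_smul_add_smul (hu : ContDiffAt ℝ 2 u x) (hv : ContDiffAt ℝ 2 v x) (s t : ℝ) :
    fderiv ℝ (fderiv ℝ (s • u + t • v)) x =
      s • fderiv ℝ (fderiv ℝ u) x + t • fderiv ℝ (fderiv ℝ v) x := by
  have h : fderiv ℝ (s • u + t • v) =ᶠ[nhds x] s • fderiv ℝ u + t • fderiv ℝ v := by
    filter_upwards [hu.eventually (by simp), hv.eventually (by simp)] with y h1 h2
    have h1 := h1.differentiableAt (by norm_num)
    have h2 := h2.differentiableAt (by norm_num)
    rw [fderiv_add (h1.const_smul s) (h2.const_smul t), fderiv_const_smul h1, fderiv_const_smul h2]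
    rfl
  have h1 := differentiableAt_fderiv_of_contDiffAt_two hu
  have h2 := differentiableAt_fderiv_of_contDiffAt_two hv
  rw [h.fderiv_eq, fderiv_add (h1.const_smul s) (h2.const_smul t), fderiv_const_smul h1,
    fderiv_const_smul h2]

lemma fderiv_fderiv_comm (hu : ContDiffAt ℝ 2 u x) (v w : E) :
    fderiv ℝ (fderiv ℝ u) x v w = fderiv ℝ (fderiv ℝ u) x w v :=
  hu.isSymmSndFDerivAt (by simp) v w

end SecondDerivative

section Euclidean

variable {u v : EuclideanSpace ℝ (Fin n) → ℝ} {x : EuclideanSpace ℝ (Fin n)}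

lemma hess_apply (hu : ContDiffAt ℝ 2 u x) (i j : Fin n) :
    hess u x i j =
      fderiv ℝ (fderiv ℝ u) x (EuclideanSpace.single i 1) (EuclideanSpace.single j 1) := by
  simp only [hess, of_apply]
  rw [fderiv_clm_apply (differentiableAt_fderiv_of_contDiffAt_two hu)
    (differentiableAt_const _)]
  simp

lemma hess_isSymm (hu : ContDiffAt ℝ 2 u x) : (hess u x).IsSymm := by
  ext i j
  rw [transpose_apply, hess_apply hu, hess_apply hu, fderiv_fderiv_comm hu]

lemma hess_smul_add_smul (hu : ContDiffAt ℝ 2 u x) (hv : ContDiffAt ℝ 2 v x) (s t : ℝ) :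
    hess (s • u + t • v) x = s • hess u x + t • hess v x := by
  ext i j
  have h : ContDiffAt ℝ 2 (s • u + t • v) x := (hu.const_smul s).add (hv.const_smul t)
  rw [hess_apply h, fderiv_fderiv_smul_add_smul hu hv]
  simp [hess_apply hu, hess_apply hv]

end Euclidean

/-! ### The spherical Hessian via the radial extension. -/

section Sphere

lemma radialExt_of_ne_zero {F : Type*} [Zero F] (f : Sph n → F)
    {y : EuclideanSpace ℝ (Fin (n + 1))} (hy : y ≠ 0) :
    radialExt f y = f ⟨‖y‖⁻¹ • y, by simp [norm_smul, hy]⟩ :=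
  Subtype.val_injective.extend_apply f 0 ⟨‖y‖⁻¹ • y, _⟩

lemma radialExt_smul_add_smul (u v : Sph n → ℝ) (s t : ℝ) :
    radialExt (s • u + t • v) = s • radialExt u + t • radialExt v := by
  ext y
  simp only [radialExt, Pi.add_apply, Pi.smul_apply]
  by_cases h : ∃ z : Sph n, (z : EuclideanSpace ℝ (Fin (n + 1))) = ‖y‖⁻¹ • y
  · obtain ⟨z, hz⟩ := h
    simp only [← hz, Subtype.val_injective.extend_apply, Pi.add_apply, Pi.smul_apply]
  · simp [Function.extend_apply' _ _ _ h]

lemma contDiffAt_normalize {y : EuclideanSpace ℝ (Fin (n + 1))} (hy : y ≠ 0) :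
    ContDiffAt ℝ 2 (fun z : EuclideanSpace ℝ (Fin (n + 1)) => ‖z‖⁻¹ • z) y :=
  ((contDiffAt_norm ℝ hy).inv (norm_ne_zero_iff.2 hy)).smul contDiffAt_id

lemma contDiffAt_radialExt {u : Sph n → ℝ} (hu : ContMDiff (𝓡 n) 𝓘(ℝ, ℝ) 2 u)
    {y : EuclideanSpace ℝ (Fin (n + 1))} (hy : y ≠ 0) : ContDiffAt ℝ 2 (radialExt u) y := by
  let U : TopologicalSpace.Opens (EuclideanSpace ℝ (Fin (n + 1))) := ⟨{0}ᶜ, isOpen_compl_singleton⟩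
  have hr : ContMDiff 𝓘(ℝ, EuclideanSpace ℝ (Fin (n + 1)))
      𝓘(ℝ, EuclideanSpace ℝ (Fin (n + 1))) 2 (fun z : U => ‖(z : EuclideanSpace ℝ (Fin (n + 1)))‖⁻¹ •
        (z : EuclideanSpace ℝ (Fin (n + 1)))) := by
    intro z
    refine (contMDiffAt_subtype_iff (U := U)
      (f := fun z : EuclideanSpace ℝ (Fin (n + 1)) => ‖z‖⁻¹ • z)).2 ?_
    exact (contDiffAt_normalize z.2).contMDiffAt
  have := Fact.mk (finrank_euclideanSpace_fin (𝕜 := ℝ) (n := n + 1))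
  have hc := hu.comp (hr.codRestrict_sphere (n := n)
    (fun z => by
      have hz : (z : EuclideanSpace ℝ (Fin (n + 1))) ≠ 0 := z.2
      simp [norm_smul, hz]))
  have := (contMDiffAt_subtype_iff (U := U) (f := radialExt u) (x := ⟨y, hy⟩)
    (I := 𝓘(ℝ, EuclideanSpace ℝ (Fin (n + 1)))) (I' := 𝓘(ℝ, ℝ)) (n := 2)).1 (by
      convert hc ⟨y, hy⟩ using 1
      ext z
      exact radialExt_of_ne_zero u z.2)
  exact contMDiffAt_iff_contDiffAt.1 this

lemma sph_ne_zero (x : Sph n) : (x : EuclideanSpace ℝ (Fin (n + 1))) ≠ 0 :=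
  ne_zero_of_mem_unit_sphere x

lemma normalize_coe (x : Sph n) :
    ‖(x : EuclideanSpace ℝ (Fin (n + 1)))‖⁻¹ • (x : EuclideanSpace ℝ (Fin (n + 1))) = x := by
  simp

lemma fderiv_normalize_of_orthogonal (x : Sph n) {v : EuclideanSpace ℝ (Fin (n + 1))}
    (hv : inner ℝ (x : EuclideanSpace ℝ (Fin (n + 1))) v = 0) :
    fderiv ℝ (fun z : EuclideanSpace ℝ (Fin (n + 1)) => ‖z‖⁻¹ • z) x v = v := by
  have hx := sph_ne_zero x
  have hsq : HasFDerivAt (fun z : EuclideanSpace ℝ (Fin (n + 1)) => ‖z‖ ^ 2) _ x.1 :=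
    (hasStrictFDerivAt_norm_sq (x : EuclideanSpace ℝ (Fin (n + 1)))).hasFDerivAt
  have hn := hsq.sqrt (by simp)
  simp only [Real.sqrt_sq (norm_nonneg _)] at hn
  have hi := (hasDerivAt_inv (norm_ne_zero_iff.2 hx)).comp_hasFDerivAt _ hn
  have := hi.smul (hasFDerivAt_id (x : EuclideanSpace ℝ (Fin (n + 1))))
  have he := this.fderiv
  change fderiv ℝ (fun z : EuclideanSpace ℝ (Fin (n + 1)) => ‖z‖⁻¹ • z) x = _ at he
  rw [he]
  simp [hv]

/-- The extended gradient is the gradient of `radialExt u` evaluated at `y/|y|`. The derivative of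
`y ↦ y/|y|` at `x` fixes tangent vectors, so the chain rule leaves the ordinary second derivative.
-/
lemma covHess_eq {u : Sph n → ℝ} (hu : ContMDiff (𝓡 n) 𝓘(ℝ, ℝ) 2 u) (x : Sph n)
    {v : EuclideanSpace ℝ (Fin (n + 1))}
    (hv : inner ℝ (x : EuclideanSpace ℝ (Fin (n + 1))) v = 0)
    (w : EuclideanSpace ℝ (Fin (n + 1))) :
    covHess u x v w = fderiv ℝ (fderiv ℝ (radialExt u)) x v w := by
  have hx := sph_ne_zero x
  -- The inverse Riesz map is only declared conjugate-linear; over `ℝ` it is repackaged as a linear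
  -- map, to enter the chain rule.
  let T : StrongDual ℝ (EuclideanSpace ℝ (Fin (n + 1))) →L[ℝ] EuclideanSpace ℝ (Fin (n + 1)) :=
    LinearMap.toContinuousLinearMap
      { toFun := (InnerProductSpace.toDual ℝ (EuclideanSpace ℝ (Fin (n + 1)))).symm
        map_add' := map_add _
        map_smul' := by simp }
  have hev : radialExt (sphGrad u) =ᶠ[nhds (x : EuclideanSpace ℝ (Fin (n + 1)))]
      fun y => T (fderiv ℝ (radialExt u) (‖y‖⁻¹ • y)) := by
    filter_upwards [isOpen_compl_singleton.mem_nhds hx] with y hy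
    rw [radialExt_of_ne_zero _ hy]
    rfl
  have h2 : HasFDerivAt (fderiv ℝ (radialExt u)) (fderiv ℝ (fderiv ℝ (radialExt u)) x)
      (‖(x : EuclideanSpace ℝ (Fin (n + 1)))‖⁻¹ • (x : EuclideanSpace ℝ (Fin (n + 1)))) := by
    rw [normalize_coe]
    exact (differentiableAt_fderiv_of_contDiffAt_two (contDiffAt_radialExt hu hx)).hasFDerivAt
  have hr := ((contDiffAt_normalize hx).differentiableAt (by simp)).hasFDerivAt
  have hc := T.hasFDerivAt.comp (x : EuclideanSpace ℝ (Fin (n + 1))) (HasFDerivAt.comp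
    (f := fun z : EuclideanSpace ℝ (Fin (n + 1)) => ‖z‖⁻¹ • z)
    (x : EuclideanSpace ℝ (Fin (n + 1))) h2 hr)
  rw [covHess, hev.fderiv_eq]
  have he := hc.fderiv
  change fderiv ℝ (fun y => T (fderiv ℝ (radialExt u) (‖y‖⁻¹ • y))) x = _ at he
  rw [he]
  simp only [ContinuousLinearMap.comp_apply, fderiv_normalize_of_orthogonal x hv]
  exact InnerProductSpace.toDual_symm_apply

variable {u v : Sph n → ℝ}

lemma inner_orthonormalBasis_TSph (x : Sph n) (e : OrthonormalBasis (Fin n) ℝ (TSph x))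
    (i : Fin n) : inner ℝ (x : EuclideanSpace ℝ (Fin (n + 1))) (e i).1 = 0 :=
  Submodule.mem_orthogonal_singleton_iff_inner_right.1 (e i).2

lemma W_apply (hu : ContMDiff (𝓡 n) 𝓘(ℝ, ℝ) 2 u) (x : Sph n)
    (e : OrthonormalBasis (Fin n) ℝ (TSph x)) (i j : Fin n) :
    W u x e i j = fderiv ℝ (fderiv ℝ (radialExt u)) x (e i).1 (e j).1 +
      u x * (if i = j then 1 else 0) := by
  rw [W, of_apply, covHess_eq hu x (inner_orthonormalBasis_TSph x e i)]

lemma W_isSymm (hu : ContMDiff (𝓡 n) 𝓘(ℝ, ℝ) 2 u) (x : Sph n)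
    (e : OrthonormalBasis (Fin n) ℝ (TSph x)) : (W u x e).IsSymm := by
  ext i j
  rw [transpose_apply, W_apply hu, W_apply hu,
    fderiv_fderiv_comm (contDiffAt_radialExt hu (sph_ne_zero x))]
  simp only [eq_comm]

lemma contMDiff_smul_add_smul (hu : ContMDiff (𝓡 n) 𝓘(ℝ, ℝ) 2 u)
    (hv : ContMDiff (𝓡 n) 𝓘(ℝ, ℝ) 2 v) (s t : ℝ) :
    ContMDiff (𝓡 n) 𝓘(ℝ, ℝ) 2 (s • u + t • v) :=
  ((contDiff_const_smul s).contMDiff.comp hu).add ((contDiff_const_smul t).contMDiff.comp hv)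

lemma W_smul_add_smul (hu : ContMDiff (𝓡 n) 𝓘(ℝ, ℝ) 2 u) (hv : ContMDiff (𝓡 n) 𝓘(ℝ, ℝ) 2 v)
    (x : Sph n) (e : OrthonormalBasis (Fin n) ℝ (TSph x)) (s t : ℝ) :
    W (s • u + t • v) x e = s • W u x e + t • W v x e := by
  ext i j
  have hx := sph_ne_zero x
  rw [W_apply (contMDiff_smul_add_smul hu hv s t), radialExt_smul_add_smul,
    fderiv_fderiv_smul_add_smul (contDiffAt_radialExt hu hx) (contDiffAt_radialExt hv hx)]
  simp only [_root_.add_apply, _root_.smul_apply, Pi.add_apply,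
    Pi.smul_apply, smul_eq_mul, Matrix.add_apply, Matrix.smul_apply, W_apply hu, W_apply hv]
  ring

end Sphere

/-! ### Concavity of the operators and convexity of the admissible sets. -/

lemma concaveOn_G_eigenvals_comp {V : Type*} [AddCommGroup V] [Module ℝ V] {D : Set V}
    {H : V → Matrix (Fin n) (Fin n) ℝ} {k : ℕ} (hk : 1 ≤ k) {a : ℕ → ℝ}
    (ha : ∀ l < k - 1, 0 ≤ a l) (hD : Convex ℝ D) (hmem : ∀ u ∈ D, H u ∈ MatGam n (k - 1))
    (hH : ∀ u ∈ D, ∀ v ∈ D, ∀ s t : ℝ, H (s • u + t • v) = s • H u + t • H v) :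
    ConcaveOn ℝ D fun u => G k a (eigenvals (H u)) := by
  refine ⟨hD, fun u hu v hv s t hs ht hst => ?_⟩
  simp only [hH u hu v hv]
  exact (concaveOn_G_eigenvals hk ha).2 (hmem u hu) (hmem v hv) hs ht hst

lemma convex_AdmEuclid (m : ℕ) {Ω : Set (EuclideanSpace ℝ (Fin n))} (hΩ : IsOpen Ω) :
    Convex ℝ (AdmEuclid m Ω) := by
  intro u hu v hv s t hs ht hst
  refine ⟨(hu.1.const_smul s).add (hv.1.const_smul t), fun x hx => ?_⟩
  rw [hess_smul_add_smul (hu.1.contDiffAt (hΩ.mem_nhds hx)) (hv.1.contDiffAt (hΩ.mem_nhds hx))]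
  -- Only the convexity of `MatGam n m` is wanted here, so the coefficients are taken to be zero.
  exact (concaveOn_G_eigenvals (k := m + 1) (a := 0) (by omega) (by simp)).1
    (hu.2 x hx) (hv.2 x hx) hs ht hst

lemma convex_AdmSph (m : ℕ) (e : ∀ x : Sph n, OrthonormalBasis (Fin n) ℝ (TSph x)) :
    Convex ℝ (AdmSph m e) := by
  intro u hu v hv s t hs ht hst
  refine ⟨contMDiff_smul_add_smul hu.1 hv.1 s t, fun x => ?_⟩
  rw [W_smul_add_smul hu.1 hv.1]
  exact (concaveOn_G_eigenvals (k := m + 1) (a := 0) (by omega) (by simp)).1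
    (hu.2 x) (hv.2 x) hs ht hst

end HessianQuotient

open HessianQuotient in
theorem proposition2p1 (n k : ℕ) (hk : 2 ≤ k) (hkn : k ≤ n) :
    -- `G` as a function of the eigenvalues `λ ∈ Γ_{k-1}`
    (∀ a : ℕ → ℝ, (∀ l < k - 1, 0 ≤ a l) →
      (∀ lam ∈ Gam n (k - 1),
        DifferentiableAt ℝ (G (n := n) k a) lam ∧
        ∀ i, 0 ≤ fderiv ℝ (G (n := n) k a) lam (Pi.single i 1) ∧
          (0 < ∑ l ∈ Finset.range (k - 1), a l →
            0 < fderiv ℝ (G (n := n) k a) lam (Pi.single i 1))) ∧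
      ConcaveOn ℝ (Gam n (k - 1)) (G (n := n) k a)) ∧
    -- `G` as a function of symmetric matrices with eigenvalues in `Γ_{k-1}`
    (∀ a : ℕ → ℝ, (∀ l < k - 1, 0 ≤ a l) →
      (∀ A ∈ MatGam n (k - 1), ∃ P : Matrix (Fin n) (Fin n) ℝ,
        P.PosSemidef ∧ (0 < ∑ l ∈ Finset.range (k - 1), a l → P.PosDef) ∧
        ∀ B : Matrix (Fin n) (Fin n) ℝ, B.IsSymm →
          HasDerivAt (fun t : ℝ => G k a (eigenvals (A + t • B)))
            (∑ i, ∑ j, P i j * B i j) 0) ∧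
      ConcaveOn ℝ (MatGam n (k - 1)) (fun A => G k a (eigenvals A))) ∧
    -- the operator `u ↦ G(λ(D²u))` on an open set of `ℝⁿ`
    (∀ (Ω : Set (EuclideanSpace ℝ (Fin n))), IsOpen Ω →
      ∀ α : ℕ → EuclideanSpace ℝ (Fin n) → ℝ, (∀ l < k - 1, ∀ x ∈ Ω, 0 ≤ α l x) →
      (∀ u ∈ AdmEuclid (k - 1) Ω, ∀ x ∈ Ω, ∃ P : Matrix (Fin n) (Fin n) ℝ,
        P.PosSemidef ∧ (0 < ∑ l ∈ Finset.range (k - 1), α l x → P.PosDef) ∧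
        ∀ φ : EuclideanSpace ℝ (Fin n) → ℝ, ContDiffOn ℝ 2 φ Ω →
          HasDerivAt (fun t : ℝ => G k (fun l => α l x) (eigenvals (hess (u + t • φ) x)))
            (∑ i, ∑ j, P i j * hess φ x i j) 0) ∧
      ∀ x ∈ Ω, ConcaveOn ℝ (AdmEuclid (k - 1) Ω)
        (fun u => G k (fun l => α l x) (eigenvals (hess u x)))) ∧
    -- the operator `u ↦ G(λ(W_u))` on the sphere, in arbitrary orthonormal frames
    (∀ (e : ∀ x : Sph n, OrthonormalBasis (Fin n) ℝ (TSph x)) (α : ℕ → Sph n → ℝ),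
      (∀ l < k - 1, ∀ x, 0 ≤ α l x) →
      (∀ u ∈ AdmSph (k - 1) e, ∀ x, ∃ P : Matrix (Fin n) (Fin n) ℝ,
        P.PosSemidef ∧ (0 < ∑ l ∈ Finset.range (k - 1), α l x → P.PosDef) ∧
        ∀ φ : Sph n → ℝ, ContMDiff (𝓡 n) 𝓘(ℝ, ℝ) 2 φ →
          HasDerivAt (fun t : ℝ => G k (fun l => α l x) (eigenvals (W (u + t • φ) x (e x))))
            (∑ i, ∑ j, P i j * W φ x (e x) i j) 0) ∧
      ∀ x, ConcaveOn ℝ (AdmSph (k - 1) e)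
        (fun u => G k (fun l => α l x) (eigenvals (W u x (e x))))) := by
  refine ⟨fun a ha => ⟨fun lam hlam => ⟨differentiableAt_G a (sigma_pos_of_mem_Gam hlam).ne',
    fderiv_G_single hk ha hlam⟩, concaveOn_G (by omega) ha⟩,
    fun a ha => ⟨fun A hA => exists_linearization hk ha hA,
      concaveOn_G_eigenvals (by omega) ha⟩, fun Ω hΩ α hα => ⟨fun u hu x hx => ?_, fun x hx => ?_⟩,
    fun e α hα => ⟨fun u hu x => ?_, fun x => ?_⟩⟩
  · have hC : ∀ {v : EuclideanSpace ℝ (Fin n) → ℝ}, ContDiffOn ℝ 2 v Ω → ContDiffAt ℝ 2 v x :=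
      fun hv =>
      hv.contDiffAt (hΩ.mem_nhds hx)
    obtain ⟨P, hP, hP', hd⟩ := exists_linearization hk (fun l hl => hα l hl x hx) (hu.2 x hx)
    refine ⟨P, hP, hP', fun φ hφ => ?_⟩
    have h := hd _ (hess_isSymm (hC hφ))
    have hlin : ∀ t : ℝ, hess (u + t • φ) x = hess u x + t • hess φ x := fun t => by
      simpa using hess_smul_add_smul (hC hu.1) (hC hφ) 1 t
    simpa only [hlin] using h
  · exact concaveOn_G_eigenvals_comp (by omega) (fun l hl => hα l hl x hx)
      (convex_AdmEuclid _ hΩ) (fun u hu => hu.2 x hx) fun u hu v hv s t =>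
        hess_smul_add_smul (hu.1.contDiffAt (hΩ.mem_nhds hx)) (hv.1.contDiffAt (hΩ.mem_nhds hx)) s t
  · obtain ⟨P, hP, hP', hd⟩ := exists_linearization hk (fun l hl => hα l hl x) (hu.2 x)
    refine ⟨P, hP, hP', fun φ hφ => ?_⟩
    have h := hd _ (W_isSymm hφ x (e x))
    have hlin : ∀ t : ℝ, W (u + t • φ) x (e x) = W u x (e x) + t • W φ x (e x) := fun t => by
      simpa using W_smul_add_smul hu.1 hφ x (e x) 1 t
    simpa only [hlin] using h
  · exact concaveOn_G_eigenvals_comp (by omega) (fun l hl => hα l hl x)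
      (convex_AdmSph _ e) (fun u hu => hu.2 x) fun u hu v hv s t =>
        W_smul_add_smul hu.1 hv.1 x (e x) s t
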